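/- Let $M$ be a set with the uniform metric (distinct points are at distance $1$). In the weighted $k$-server problem on $M$, $k\ge 1$ servers with weights $0\le w_1\le\cdots\le w_k$ occupy points of $M$, starting from a given initial configuration $C_0\in M^k$. Requests $r_1,r_2,\ldots\in M$ arrive one at a time, and each must be served, before the next one is seen, by having some server at the requested point; moving server $i$ to a different point costs $w_i$. For a finite request sequence $\rho=r_1\cdots r_m$, let $\mathrm{OPT}_w(\rho)$ be the minimum of $\sum_{t=1}^{m}\sum_{i=1}^{k} w_i\,\mathbb{I}[C'_{t-1}[i]\ne C'_t[i]]$ over all sequences of configurations $C'_0,C'_1,\ldots,C'_m\in M^k$ such that $r_t\in\{C'_t[1],\ldots,C'_t[k]\}$ for every $t\in\{1,\ldots,m\}$ (the first configuration $C'_0$ is arbitrary). Theorem 1. There is an $\exp(O(k^2))$-competitive randomized online algorithm, against an oblivious adversary, for the weighted $k$-server problem on uniform metrics. That is, there are a function $c:\mathbb{N}\to\mathbb{R}$ and a constant $K$ with $c(k)\le\exp(Kk^2)$ for all $k\ge1$, such that for every $k\ge 1$ and all weights $0\le w_1\le\cdots\le w_k$ there is a constant $c'$ such that, for every set $M$ and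 every initial configuration $C_0\in M^k$, some randomized online algorithm starting in $C_0$ has, on every finite request sequence $\rho$ of points of $M$, expected cost $$\mathrm{ALG}(\rho)\le c(k)\cdot\mathrm{OPT}_w(\rho)+c'.$$ -/

import Mathlib

universe u

namespace WeightedKServer

/-- A server configuration: the positions in `M` of the `k` servers. -/
abbrev Config (k : ℕ) (M : Type u) : Type u := Fin k → M

open Classical in
/-- The uniform metric on `M`. -/
noncomputable def uniformDist {M : Type u} (p q : M) : ℝ := if p = q then 0 else 1

/-- The cost of changing configuration: each server pays its weight times the distance through
which it moves. -/
noncomputable def moveCost {k : ℕ} {M : Type u} (w : Fin k → ℝ) (C C' : Config k M) : ℝ :=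
  ∑ i, w i * uniformDist (C i) (C' i)

/-- `𝒞 = [C₀, …, Cₘ]` is a solution to `ρ = r₁ ⋯ rₘ`: some server is at `rᵢ` in `Cᵢ`, for every
`i ∈ {1, …, m}`. The configuration `C₀` is unconstrained. -/
def IsSolution {k : ℕ} {M : Type u} (ρ : List M) (𝒞 : Fin (ρ.length + 1) → Config k M) : Prop :=
  ∀ i : Fin ρ.length, ∃ j : Fin k, 𝒞 i.succ j = ρ.get i

/-- The cost of a sequence `[C₀, …, Cₘ]` of configurations. -/
noncomputable def totalCost {k : ℕ} {M : Type u} (w : Fin k → ℝ) {m : ℕ}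
    (𝒞 : Fin (m + 1) → Config k M) : ℝ :=
  ∑ i : Fin m, moveCost w (𝒞 i.castSucc) (𝒞 i.succ)

/-- The minimum cost of a solution to `ρ` in hindsight, over all solutions, whatever their first
configuration. (The costs of the solutions to `ρ` form a finite set, so that the infimum is a
minimum as soon as a solution exists, which is the case whenever `1 ≤ k`.) -/
noncomputable def OPT {k : ℕ} {M : Type u} (w : Fin k → ℝ) (ρ : List M) : ℝ :=
  sInf {x : ℝ | ∃ 𝒞 : Fin (ρ.length + 1) → Config k M, IsSolution ρ 𝒞 ∧ x = totalCost w 𝒞}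

/-- A randomized online algorithm for `k` servers in `M`, started in the configuration `C₀`, as a
random deterministic online algorithm. The outcome `ω` of the random choices is drawn once, and
independently of the requests (the adversary is oblivious); `config ω ρ` is the configuration
after the requests `ρ` have been received and served. It is determined by `ω` and the requests
received so far, which is what makes the algorithm online. -/
structure RandomizedOnlineAlgorithm {k : ℕ} {M : Type u} (C₀ : Config k M) where
  /-- the outcomes of the random choices -/
  Ω : Type
  /-- the events -/
  events : MeasurableSpace Ω
  /-- the law of the random choices -/
  law : @MeasureTheory.Measure Ω events
  isProbability : @MeasureTheory.IsProbabilityMeasure Ω events law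
  /-- the configuration after serving a sequence of requests -/
  config : Ω → List M → Config k M
  /-- the run starts in the given initial configuration -/
  initial : ∀ ω, config ω [] = C₀
  /-- upon each request `r`, some server is brought to `r` before the next request is seen -/
  serves : ∀ ω ρ r, ∃ j : Fin k, config ω (ρ ++ [r]) j = r
  /-- on each request sequence, the run is a random element of the discrete space of runs -/
  measurable : ∀ (ρ : List M) (s : Set (Fin (ρ.length + 1) → Config k M)),
    @MeasurableSet Ω events {ω | (fun i : Fin (ρ.length + 1) => config ω (ρ.take i)) ∈ s}

namespace RandomizedOnlineAlgorithm

variable {k : ℕ} {M : Type u} {C₀ : Config k M}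

/-- The sequence of configurations of the algorithm on the requests `ρ`, for the outcome `ω`. -/
def run (A : RandomizedOnlineAlgorithm C₀) (ω : A.Ω) (ρ : List M) :
    Fin (ρ.length + 1) → Config k M :=
  fun i => A.config ω (ρ.take i)

/-- The expected cost of the algorithm on the requests `ρ`. -/
noncomputable def expectedCost (A : RandomizedOnlineAlgorithm C₀) (w : Fin k → ℝ) (ρ : List M) :
    ℝ :=
  @MeasureTheory.integral A.Ω ℝ _ _ A.events A.law fun ω => totalCost w (A.run ω ρ)

end RandomizedOnlineAlgorithm

end WeightedKServer

/-! The proof is by induction on the number of servers. Let `W` be the weight of the heaviest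
server, and let `A` be an algorithm for the `j` lighter ones. The requests are cut into phases.
While the light servers alone could serve the phase at cost at most `8 ^ j * W`, the heavy server is
parked at its initial point and `A` serves everything. After that, a point is a candidate if the
light servers could serve the requests of the phase elsewhere at cost at most `W`. The phase ends
when no candidate is left; by then every solution has paid at least `W`, since either its heavy
server moved or that server stayed at a point which is not a candidate. Candidates only disappear,
so a heavy server that sits at the first remaining candidate in a random order moves a harmonic
number of times in expectation (`exists_random_location`). For each location the light servers
simulate `A` on the requests elsewhere.

The number of candidates is bounded by a dichotomy (`opt_le_or_card_lt`): with too many of them, the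
light servers could serve all requests at cost `8 ^ j * W`. Its induction forces a generalization
from points to small disjoint sets `e i` (`DisjointCriterion`). A cheap solution outside `e i` keeps
its heaviest server at some `y i`. If many `y i` agree, the server is parked there; otherwise many
of the sets `insert (y i) (e i)` are disjoint, and one server fewer has to be considered, with sets
one point larger.

The bound on the candidates is doubly exponential in `j`, but only its logarithm enters the cost.
Each server thus multiplies the ratio by `exp(O(j))`, which gives `exp(O(k^2))` in all. -/

open scoped ENNReal

namespace WeightedKServer

/-! ### Offline optima: cutting, gluing, and removing the heaviest server -/

section Offline

variable {k : ℕ} {M : Type u}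

open Classical in
/-- The cost of changing configuration, in the extended nonnegative reals. -/
noncomputable def emoveCost (w : Fin k → ℝ≥0∞) (C C' : Config k M) : ℝ≥0∞ :=
  ∑ i, if C i = C' i then 0 else w i

/-- The least cost of serving a list of requests, starting from a given configuration. -/
noncomputable def optFrom (w : Fin k → ℝ≥0∞) : List M → Config k M → ℝ≥0∞
  | [], _ => 0
  | r :: σ, C => ⨅ (C' : Config k M) (_ : ∃ j, C' j = r), emoveCost w C C' + optFrom w σ C'

/-- The least cost of serving a list of requests, with a free choice of the first configuration. -/
noncomputable def opt (w : Fin k → ℝ≥0∞) (σ : List M) : ℝ≥0∞ := ⨅ C, optFrom w σ C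

open Classical in
/-- The list of the requests outside a given set. -/
noncomputable def avoid (s : Set M) (σ : List M) : List M := σ.filter fun r => decide (r ∉ s)

@[simp] theorem avoid_nil (s : Set M) : avoid s [] = [] := rfl

theorem avoid_append (s : Set M) (σ τ : List M) : avoid s (σ ++ τ) = avoid s σ ++ avoid s τ :=
  List.filter_append ..

theorem avoid_cons_of_mem {s : Set M} {r : M} (h : r ∈ s) (σ : List M) :
    avoid s (r :: σ) = avoid s σ := by simp [avoid, h]

theorem avoid_cons_of_notMem {s : Set M} {r : M} (h : r ∉ s) (σ : List M) :
    avoid s (r :: σ) = r :: avoid s σ := by simp [avoid, h]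

theorem mem_avoid {s : Set M} {r : M} {σ : List M} : r ∈ avoid s σ ↔ r ∈ σ ∧ r ∉ s := by
  simp [avoid]

theorem avoid_avoid (s t : Set M) (σ : List M) : avoid s (avoid t σ) = avoid (s ∪ t) σ := by
  simp only [avoid, List.filter_filter]
  congr 1
  funext r
  by_cases h : r ∈ s <;> by_cases h' : r ∈ t <;> simp [h, h']

@[simp] theorem avoid_empty (σ : List M) : avoid ∅ σ = σ := by simp [avoid]

@[simp] theorem emoveCost_self (w : Fin k → ℝ≥0∞) (C : Config k M) : emoveCost w C C = 0 := by
  simp [emoveCost]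

theorem emoveCost_triangle (w : Fin k → ℝ≥0∞) (C C' C'' : Config k M) :
    emoveCost w C C'' ≤ emoveCost w C C' + emoveCost w C' C'' := by
  classical
  unfold emoveCost
  rw [← Finset.sum_add_distrib]
  refine Finset.sum_le_sum fun i _ => ?_
  split_ifs <;> simp_all

theorem emoveCost_le_sum (w : Fin k → ℝ≥0∞) (C C' : Config k M) :
    emoveCost w C C' ≤ ∑ i, w i := by
  classical
  refine Finset.sum_le_sum fun i _ => ?_
  split_ifs <;> simp

theorem emoveCost_succ (w : Fin (k + 1) → ℝ≥0∞) (C C' : Config (k + 1) M)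
    (h : C (Fin.last k) = C' (Fin.last k)) :
    emoveCost w C C' = emoveCost (Fin.init w) (Fin.init C) (Fin.init C') := by
  simp only [emoveCost, Fin.sum_univ_castSucc, h, if_true, add_zero]
  rfl

theorem le_emoveCost_of_ne (w : Fin k → ℝ≥0∞) {C C' : Config k M} {i : Fin k} (h : C i ≠ C' i) :
    w i ≤ emoveCost w C C' := by
  classical
  have := Finset.single_le_sum (f := fun i => if C i = C' i then 0 else w i)
    (fun _ _ => zero_le) (Finset.mem_univ i)
  simp only [h, if_false] at this
  exact this

theorem opt_le_optFrom (w : Fin k → ℝ≥0∞) (σ : List M) (C : Config k M) :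
    opt w σ ≤ optFrom w σ C := iInf_le _ C

theorem optFrom_cons_le (w : Fin k → ℝ≥0∞) {r : M} (σ : List M) (C : Config k M) {C' : Config k M}
    (h : ∃ j, C' j = r) : optFrom w (r :: σ) C ≤ emoveCost w C C' + optFrom w σ C' :=
  iInf₂_le C' h

theorem optFrom_le_emoveCost_add (w : Fin k → ℝ≥0∞) (σ : List M) (C C' : Config k M) :
    optFrom w σ C ≤ emoveCost w C C' + optFrom w σ C' := by
  cases σ with
  | nil => simp [optFrom]
  | cons r σ =>
    rw [optFrom.eq_2 w C' r σ]
    simp only [ENNReal.add_iInf]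
    refine le_iInf₂ fun D hD => (optFrom_cons_le w σ C hD).trans ?_
    rw [← add_assoc]
    gcongr
    exact emoveCost_triangle ..

@[simp] theorem opt_nil [Nonempty M] (w : Fin k → ℝ≥0∞) : opt w ([] : List M) = 0 := by
  simp [opt, optFrom]

theorem optFrom_add_opt_le (w : Fin k → ℝ≥0∞) (σ τ : List M) (C : Config k M) :
    optFrom w σ C + opt w τ ≤ optFrom w (σ ++ τ) C := by
  induction σ generalizing C with
  | nil => simpa [optFrom] using opt_le_optFrom w τ C
  | cons r σ ih =>
    refine le_iInf₂ fun C' h => ?_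
    calc _ ≤ emoveCost w C C' + optFrom w σ C' + opt w τ := by
          gcongr; exact optFrom_cons_le w σ C h
      _ ≤ _ := by rw [add_assoc]; gcongr; exact ih C'

/-- The second optimum may start for free wherever a solution to the whole stands after `σ`. -/
theorem opt_add_opt_le (w : Fin k → ℝ≥0∞) (σ τ : List M) :
    opt w σ + opt w τ ≤ opt w (σ ++ τ) :=
  le_iInf fun C => (add_le_add_left (opt_le_optFrom w σ C) _).trans (optFrom_add_opt_le w σ τ C)

theorem optFrom_concat_add_opt_cons_le (w : Fin k → ℝ≥0∞) (σ : List M) (r : M) (τ : List M)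
    (C : Config k M) :
    optFrom w (σ ++ [r]) C + opt w (r :: τ) ≤ optFrom w (σ ++ r :: τ) C := by
  induction σ generalizing C with
  | nil =>
    refine le_iInf₂ fun C' h => ?_
    refine add_le_add ((optFrom_cons_le w [] C h).trans (by simp [optFrom])) ?_
    exact (opt_le_optFrom w _ C').trans ((optFrom_cons_le w τ C' h).trans (by simp))
  | cons s σ ih =>
    refine le_iInf₂ fun C' h => ?_
    calc _ ≤ emoveCost w C C' + optFrom w (σ ++ [r]) C' + opt w (r :: τ) := by
          gcongr; exact optFrom_cons_le w _ C h
      _ ≤ _ := by rw [add_assoc]; gcongr; exact ih C'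

/-- The configuration that serves `r` is a free start for what follows, so `r` may be counted in
both parts. -/
theorem opt_concat_add_opt_cons_le (w : Fin k → ℝ≥0∞) (σ : List M) (r : M) (τ : List M) :
    opt w (σ ++ [r]) + opt w (r :: τ) ≤ opt w (σ ++ r :: τ) :=
  le_iInf fun C => (add_le_add_left (opt_le_optFrom w _ C) _).trans
    (optFrom_concat_add_opt_cons_le w σ r τ C)

theorem optFrom_append_le (w : Fin k → ℝ≥0∞) (σ τ : List M) (C : Config k M) :
    optFrom w (σ ++ τ) C ≤ optFrom w σ C + (∑ i, w i + opt w τ) := by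
  induction σ generalizing C with
  | nil =>
    simp only [optFrom, opt, ENNReal.add_iInf, List.nil_append, zero_add]
    exact le_iInf fun C' => (optFrom_le_emoveCost_add w τ C C').trans
      (add_le_add_left (emoveCost_le_sum ..) _)
  | cons r σ ih =>
    rw [optFrom.eq_2 w C r σ, ENNReal.iInf_add]
    simp only [ENNReal.iInf_add]
    refine le_iInf₂ fun C' h => (optFrom_cons_le w _ C h).trans ?_
    rw [add_assoc]
    gcongr
    exact ih C'

theorem opt_append_le (w : Fin k → ℝ≥0∞) (σ τ : List M) :
    opt w (σ ++ τ) ≤ opt w σ + (∑ i, w i + opt w τ) := by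
  rw [opt.eq_1 w σ, ENNReal.iInf_add]
  exact le_iInf fun C => (opt_le_optFrom w _ C).trans (optFrom_append_le w σ τ C)

theorem opt_singleton (w : Fin (k + 1) → ℝ≥0∞) (r : M) : opt w [r] = 0 := by
  refine le_antisymm ((opt_le_optFrom w _ fun _ => r).trans ?_) zero_le
  refine (optFrom_cons_le w [] _ (C' := fun _ => r) ⟨0, rfl⟩).trans ?_
  simp [optFrom]

/-- The infimum is over the empty set. The value `⊤` marks infeasibility, which lets the inductions
start with zero servers. -/
theorem optFrom_cons_zero (w : Fin 0 → ℝ≥0∞) (r : M) (σ : List M) (C : Config 0 M) :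
    optFrom w (r :: σ) C = ⊤ := by
  simp [optFrom]

theorem opt_ne_top_zero {w : Fin 0 → ℝ≥0∞} {σ : List M} (h : opt w σ ≠ ⊤) : σ = [] := by
  cases σ with
  | nil => rfl
  | cons r σ => simp [opt, optFrom_cons_zero] at h

/-- Adding a server, which never moves, serves the requests at its location for free. -/
theorem optFrom_snoc_le (w : Fin (k + 1) → ℝ≥0∞) {s : Set M} {y : M} (hs : s ⊆ {y}) (σ : List M)
    (C : Config k M) :
    optFrom w σ (Fin.snoc C y : Config (k + 1) M) ≤ optFrom (Fin.init w) (avoid s σ) C := by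
  have key : ∀ C C' : Config k M, emoveCost w (Fin.snoc C y : Config (k + 1) M)
      (Fin.snoc C' y : Config (k + 1) M) = emoveCost (Fin.init w) C C' := fun C C' => by
    rw [emoveCost_succ _ _ _ (by simp)]; simp
  induction σ generalizing C with
  | nil => simp [optFrom]
  | cons r σ ih =>
    by_cases hr : r ∈ s
    · obtain rfl : r = y := hs hr
      rw [avoid_cons_of_mem hr]
      refine (optFrom_cons_le w σ _ (C' := (Fin.snoc C r : Config (k + 1) M))
        ⟨Fin.last k, by simp⟩).trans ?_
      simpa using ih C
    · rw [avoid_cons_of_notMem hr]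
      refine le_iInf₂ fun C' ⟨j, hj⟩ => ?_
      refine (optFrom_cons_le w σ _ (C' := (Fin.snoc C' y : Config (k + 1) M))
        ⟨j.castSucc, by simpa using hj⟩).trans ?_
      rw [key]
      gcongr
      exact ih C'

theorem opt_succ_le (w : Fin (k + 1) → ℝ≥0∞) {s : Set M} {y : M} (hs : s ⊆ {y}) (σ : List M) :
    opt w σ ≤ opt (Fin.init w) (avoid s σ) :=
  le_iInf fun C => (opt_le_optFrom w σ _).trans (optFrom_snoc_le w hs σ C)

/-- A solution in which the last server moves pays its weight; one in which it never moves is a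
solution for the other servers to the requests elsewhere. -/
theorem min_le_optFrom (w : Fin (k + 1) → ℝ≥0∞) (σ : List M) (C : Config (k + 1) M) :
    min (w (Fin.last k)) (optFrom (Fin.init w) (avoid {C (Fin.last k)} σ) (Fin.init C)) ≤
      optFrom w σ C := by
  induction σ generalizing C with
  | nil => simp [optFrom]
  | cons r σ ih =>
    refine le_iInf₂ fun C' ⟨j, hj⟩ => ?_
    by_cases h : C (Fin.last k) = C' (Fin.last k)
    · rw [emoveCost_succ w C C' h]
      have ih := ih C'
      rw [← h] at ih
      have step : optFrom (Fin.init w) (avoid {C (Fin.last k)} (r :: σ)) (Fin.init C) ≤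
          emoveCost (Fin.init w) (Fin.init C) (Fin.init C') +
            optFrom (Fin.init w) (avoid {C (Fin.last k)} σ) (Fin.init C') := by
        by_cases hr : r = C (Fin.last k)
        · rw [avoid_cons_of_mem (by simpa using hr)]
          exact optFrom_le_emoveCost_add ..
        · rw [avoid_cons_of_notMem (by simpa using hr)]
          refine optFrom_cons_le _ _ _ ?_
          induction j using Fin.lastCases with
          | last => exact absurd (hj.symm.trans h.symm) hr
          | cast j => exact ⟨j, hj⟩
      rcases le_total (w (Fin.last k))
        (optFrom (Fin.init w) (avoid {C (Fin.last k)} σ) (Fin.init C')) with h1 | h1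
      · rw [min_eq_left h1] at ih
        exact (min_le_left _ _).trans (ih.trans le_add_self)
      · rw [min_eq_right h1] at ih
        exact (min_le_right _ _).trans (step.trans (by gcongr))
    · exact (min_le_left _ _).trans ((le_emoveCost_of_ne w h).trans le_self_add)

/-- The witness is the initial point of the last server in a starting configuration of cost below
its weight: that server cannot afford to move. -/
theorem exists_opt_avoid_lt {w : Fin (k + 1) → ℝ≥0∞} {σ : List M}
    (h : opt w σ < w (Fin.last k)) : ∃ y, opt (Fin.init w) (avoid {y} σ) < w (Fin.last k) := by
  obtain ⟨C, hC⟩ := iInf_lt_iff.1 h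
  refine ⟨C (Fin.last k), (opt_le_optFrom _ _ (Fin.init C)).trans_lt ?_⟩
  by_contra! h'
  have := min_le_optFrom w σ C
  rw [min_eq_left h'] at this
  exact absurd hC this.not_gt

end Offline

/-! ### The dichotomy: cheap service of everything, or few candidates -/

section Dichotomy

/-- In a finite set where every element conflicts with at most `d` elements, there
are many elements without conflicts among them. -/
theorem exists_pairwise_not_of_card_filter_le {ι : Type*} [DecidableEq ι] (R : ι → ι → Prop)
    [DecidableRel R] (hsymm : ∀ i j, R i j → R j i) (hrefl : ∀ i, R i i) (d n : ℕ) (J : Finset ι)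
    (hd : ∀ i ∈ J, (J.filter (R i)).card ≤ d) (hJ : n * d ≤ J.card) (hd0 : 0 < d) :
    ∃ I ⊆ J, I.card = n ∧ (I : Set ι).Pairwise fun i j => ¬ R i j := by
  induction n generalizing J with
  | zero => exact ⟨∅, by simp, by simp, by simp⟩
  | succ n ih =>
    rw [Nat.succ_mul] at hJ
    obtain ⟨i, hi⟩ : J.Nonempty := Finset.card_pos.1 (by omega)
    have hcard := Finset.card_filter_add_card_filter_not (s := J) (R i)
    have := hd i hi
    obtain ⟨I, hIJ, hIn, hI⟩ := ih (J.filter fun j => ¬ R i j)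
      (fun j hj => (Finset.card_le_card
        (Finset.filter_subset_filter _ (Finset.filter_subset _ _))).trans
        (hd j (Finset.mem_filter.1 hj).1)) (by omega)
    have hni : i ∉ I := fun h => (Finset.mem_filter.1 (hIJ h)).2 (hrefl i)
    refine ⟨insert i I, ?_, by simp [hni, hIn], ?_⟩
    · exact Finset.insert_subset hi (hIJ.trans (Finset.filter_subset _ _))
    · rw [Finset.coe_insert]
      refine hI.insert fun j hj _ => ?_
      have hij := (Finset.mem_filter.1 (hIJ hj)).2
      exact ⟨hij, fun h => hij (hsymm _ _ h)⟩

theorem exists_first_not {α : Type*} (P : List α → Prop) (h0 : P []) {σ : List α} (h : ¬ P σ) :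
    ∃ τ r υ, σ = τ ++ r :: υ ∧ P τ ∧ ¬ P (τ ++ [r]) := by
  induction σ using List.reverseRecOn with
  | nil => exact absurd h0 h
  | append_singleton σ r ih =>
    by_cases hσ : P σ
    · exact ⟨σ, r, [], by simp, hσ, h⟩
    · obtain ⟨τ, s, υ, rfl, h1, h2⟩ := ih hσ
      exact ⟨τ, s, υ ++ [r], by simp, h1, h2⟩

/-- The exponent of two in `dichotomyBound`. -/
def dichotomyExponent (K : ℕ) : ℕ → ℕ
  | 0 => 1
  | j + 1 => K + 2 + 2 * dichotomyExponent K j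

/-- The number of disjoint sets which suffice in `opt_le_of_disjoint`. -/
def dichotomyBound (K j : ℕ) : ℕ := 2 ^ dichotomyExponent K j

/-- The factor `2` allows half of the sets to be cheap on a piece of the requests. One factor
`dichotomyBound K j` is the number of conflict-free indices needed; the other, with `s + 2 ≤ 2 ^ (K
+ 1)`, bounds the conflicts of one index. -/
theorem dichotomyBound_succ (K j : ℕ) :
    dichotomyBound K (j + 1) = 2 * (2 ^ (K + 1) * dichotomyBound K j ^ 2) := by
  simp only [dichotomyBound, dichotomyExponent]
  ring

theorem dichotomyBound_pos (K j : ℕ) : 0 < dichotomyBound K j := by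
  unfold dichotomyBound; positivity

theorem add_two_le_two_pow {s K : ℕ} (h : s ≤ K) : s + 2 ≤ 2 ^ (K + 1) := by
  have : K + 1 < 2 ^ (K + 1) := Nat.lt_two_pow_self
  omega

/-- The left side is `2 * (8 ^ j + 2 * (j + 1)) + 8 ^ j`, the total in `disjointCriterion_succ`;
this is where the base `8` comes from. -/
theorem three_mul_eight_pow_add_le (j : ℕ) : 3 * 8 ^ j + 4 * (j + 1) ≤ 8 ^ (j + 1) := by
  induction j with
  | zero => norm_num
  | succ j ih => rw [pow_succ] at ih ⊢; rw [pow_succ]; omega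

variable {M : Type u}

/-- For `j` servers and `dichotomyBound K j` disjoint sets of at most `s` points: if the requests
outside each of the sets can be served cheaply, then so can all requests. -/
def DisjointCriterion (M : Type u) (K j s : ℕ) : Prop :=
  ∀ (w : Fin j → ℝ≥0∞), Monotone w → ∀ (W : ℝ≥0∞), (∀ i, w i ≤ W) →
    ∀ (σ : List M) (I : Finset M) (e : M → Finset M),
      (I : Set M).PairwiseDisjoint e → (∀ i ∈ I, (e i).card ≤ s) → dichotomyBound K j ≤ I.card →
      (∀ i ∈ I, opt w (avoid (e i) σ) ≤ W) → opt w σ ≤ 8 ^ j * W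

theorem disjointCriterion_zero [Nonempty M] (K s : ℕ) : DisjointCriterion M K 0 s := by
  intro w _ W _ σ I e he _ hI h
  rcases eq_or_ne W ⊤ with rfl | hW
  · simp
  have hcard : 1 < I.card := by
    simp only [dichotomyBound, dichotomyExponent] at hI
    omega
  obtain ⟨i, hi, j, hj, hij⟩ := Finset.one_lt_card.1 hcard
  have key : ∀ i ∈ I, ∀ r ∈ σ, r ∈ e i := fun i hi r hr => by
    by_contra hri
    have h1 := opt_ne_top_zero (ne_top_of_le_ne_top hW (h i hi))
    have : r ∈ avoid (e i : Set M) σ := mem_avoid.2 ⟨hr, by simpa using hri⟩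
    simp [h1] at this
  have : σ = [] := by
    rw [List.eq_nil_iff_forall_not_mem]
    intro r hr
    exact Finset.disjoint_left.1 (he hi hj hij) (key i hi r hr) (key j hj r hr)
  simp [this]

open Classical in
/-- If, for many disjoint sets, the requests outside the set can be served without moving the last
server, then all requests can be served cheaply. -/
theorem opt_le_of_disjoint_of_lt {K j s : ℕ} (hsK : s ≤ K) (ih : DisjointCriterion M K j s)
    (ih' : DisjointCriterion M K j (s + 1)) (w : Fin (j + 1) → ℝ≥0∞) (hw : Monotone w)
    (σ : List M) (J : Finset M) (e : M → Finset M) (he : (J : Set M).PairwiseDisjoint e)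
    (hs : ∀ i ∈ J, (e i).card ≤ s) (hJ : 2 ^ (K + 1) * dichotomyBound K j ^ 2 ≤ J.card)
    (h : ∀ i ∈ J, opt w (avoid (e i) σ) < w (Fin.last j)) :
    opt w σ ≤ 8 ^ j * w (Fin.last j) := by
  have hN := dichotomyBound_pos K j
  have hw' : Monotone (Fin.init w) := fun a b hab => hw (Fin.castSucc_le_castSucc_iff.2 hab)
  have hlast : ∀ i, Fin.init w i ≤ w (Fin.last j) := fun i => hw (Fin.le_last _)
  have hJne : J.Nonempty := Finset.card_pos.1 (lt_of_lt_of_le (by positivity) hJ)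
  choose! y hy using fun i (hi : i ∈ J) => exists_opt_avoid_lt (h i hi)
  by_cases hstar : ∃ z, dichotomyBound K j ≤ (J.filter fun i => y i = z).card
  · obtain ⟨z, hz⟩ := hstar
    refine (opt_succ_le w (s := {z}) subset_rfl σ).trans ?_
    refine ih _ hw' _ hlast _ (J.filter fun i => y i = z) e
      (he.subset (Finset.coe_subset.2 (Finset.filter_subset _ _))) (fun i hi => hs i (Finset.mem_filter.1 hi).1) hz fun i hi => ?_
    obtain ⟨hi, hiz⟩ := Finset.mem_filter.1 hi
    rw [avoid_avoid, Set.union_comm, ← avoid_avoid, ← hiz]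
    exact (hy i hi).le
  · push Not at hstar
    -- Fewer than `dichotomyBound K j` indices share the value `y i`, at most one of the disjoint
    -- sets contains `y i`, and each of the at most `s` points of `e i` is the value of fewer than
    -- `dichotomyBound K j` indices.
    have hcard : ∀ i ∈ J, (J.filter fun i' =>
        i = i' ∨ y i = y i' ∨ y i ∈ e i' ∨ y i' ∈ e i).card ≤ (s + 2) * dichotomyBound K j := by
      intro i hi
      have hsub : (J.filter fun i' => i = i' ∨ y i = y i' ∨ y i ∈ e i' ∨ y i' ∈ e i) ⊆
          (J.filter fun i' => y i' = y i) ∪ ((J.filter fun i' => y i ∈ e i') ∪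
            (e i).biUnion fun z => J.filter fun i' => y i' = z) := by
        intro i' hi'
        simp only [Finset.mem_filter, Finset.mem_union, Finset.mem_biUnion] at hi' ⊢
        rcases hi' with ⟨h1, rfl | h2 | h2 | h2⟩
        · exact Or.inl ⟨h1, rfl⟩
        · exact Or.inl ⟨h1, h2.symm⟩
        · exact Or.inr (Or.inl ⟨h1, h2⟩)
        · exact Or.inr (Or.inr ⟨_, h2, h1, rfl⟩)
      have h1 : (J.filter fun i' => y i ∈ e i').card ≤ 1 := by
        rw [Finset.card_le_one]
        intro a ha b hb
        simp only [Finset.mem_filter] at ha hb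
        by_contra hab
        exact Finset.disjoint_left.1 (he ha.1 hb.1 hab) ha.2 hb.2
      have h2 : ((e i).biUnion fun z => J.filter fun i' => y i' = z).card ≤
          s * dichotomyBound K j :=
        (Finset.card_biUnion_le_card_mul _ _ _ fun z _ => (hstar z).le).trans
          (Nat.mul_le_mul_right _ (hs i hi))
      have h3 := hstar (y i)
      have h4 := Finset.card_le_card hsub
      have h5 := Finset.card_union_le (J.filter fun i' => y i' = y i)
        ((J.filter fun i' => y i ∈ e i') ∪ (e i).biUnion fun z => J.filter fun i' => y i' = z)
      have h6 := Finset.card_union_le (J.filter fun i' => y i ∈ e i')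
        ((e i).biUnion fun z => J.filter fun i' => y i' = z)
      rw [add_mul]
      omega
    obtain ⟨I, hIJ, hIn, hI⟩ := exists_pairwise_not_of_card_filter_le
      (fun i i' => i = i' ∨ y i = y i' ∨ y i ∈ e i' ∨ y i' ∈ e i)
      (fun i i' => by grind) (fun i => Or.inl rfl) _ (dichotomyBound K j) J hcard
      (le_trans (by
        rw [mul_left_comm, ← sq]
        exact Nat.mul_le_mul_right _ (add_two_le_two_pow hsK)) hJ) (by positivity)
    obtain ⟨i₀, hi₀⟩ := hJne
    -- The light servers can serve every request here, so the last server is parked at an arbitrary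
    -- point.
    refine (opt_succ_le w (s := ∅) (Set.empty_subset {y i₀}) σ).trans ?_
    rw [avoid_empty]
    refine ih' _ hw' _ hlast _ I (fun i => insert (y i) (e i)) ?_ ?_ hIn.ge ?_
    · intro i hi i' hi' hne
      have hconf := hI hi hi' hne
      have hdis := he (hIJ hi) (hIJ hi') hne
      push Not at hconf
      simp only [Function.onFun, Finset.disjoint_insert_left, Finset.disjoint_insert_right,
        Finset.mem_insert, not_or]
      exact ⟨⟨fun h => hconf.2.1 h.symm, hconf.2.2.2⟩, hconf.2.2.1, hdis⟩
    · intro i hi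
      exact (Finset.card_insert_le _ _).trans (Nat.succ_le_succ (hs i (hIJ hi)))
    · intro i hi
      have := (hy i (hIJ hi)).le
      rwa [avoid_avoid, Set.singleton_union, ← Finset.coe_insert] at this

theorem sum_weight_le {k : ℕ} {w : Fin k → ℝ≥0∞} {W : ℝ≥0∞} (h : ∀ i, w i ≤ W) :
    ∑ i, w i ≤ k * W := by
  simpa using Finset.sum_le_card_nsmul Finset.univ w W fun i _ => h i

-- Cut `σ` into pieces whose optimum just exceeds `8 ^ j * a`, where `a` is the largest weight. On
-- each piece at least `n` of the `2 * n` sets leave requests of cost at least `a`. The sum over all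
-- sets is at most `2 * n * W`, so `a` times the number of pieces is at most `2 * W`.
open Classical in
theorem disjointCriterion_succ [Nonempty M] {K j s : ℕ} (hsK : s ≤ K)
    (ih : DisjointCriterion M K j s) (ih' : DisjointCriterion M K j (s + 1)) :
    DisjointCriterion M K (j + 1) s := by
  intro w hw W hW σ I e he hs hI h
  set n := 2 ^ (K + 1) * dichotomyBound K j ^ 2 with hn
  have hN := dichotomyBound_pos K j
  have hn0 : (n : ℝ≥0∞) ≠ 0 := by
    rw [Nat.cast_ne_zero]; positivity
  rw [dichotomyBound_succ, ← hn] at hI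
  obtain ⟨I', hI'I, hcard⟩ := Finset.exists_subset_card_eq hI
  have he' : (I' : Set M).PairwiseDisjoint e := he.subset (Finset.coe_subset.2 hI'I)
  set a := w (Fin.last j) with ha
  have hwa : ∀ i, w i ≤ a := fun i => hw (Fin.le_last i)
  have phase : ∀ τ : List M, ¬ opt w τ ≤ 8 ^ j * a →
      n * a ≤ ∑ i ∈ I', opt w (avoid (e i) τ) := by
    intro τ hτ
    have hlt : (I'.filter fun i => opt w (avoid (e i) τ) < a).card < n := by
      by_contra! hle
      refine hτ (opt_le_of_disjoint_of_lt hsK ih ih' w hw τ _ e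
        (he'.subset (Finset.coe_subset.2 (Finset.filter_subset _ _))) (fun i hi => hs i (hI'I (Finset.mem_filter.1 hi).1)) hle
        fun i hi => (Finset.mem_filter.1 hi).2)
    have hadd := Finset.card_filter_add_card_filter_not (s := I')
      (fun i => opt w (avoid (e i) τ) < a)
    have hge : n ≤ (I'.filter fun i => ¬ opt w (avoid (e i) τ) < a).card := by omega
    calc (n : ℝ≥0∞) * a
        ≤ ((I'.filter fun i => ¬ opt w (avoid (e i) τ) < a).card : ℝ≥0∞) * a := by gcongr
      _ ≤ ∑ i ∈ I'.filter fun i => ¬ opt w (avoid (e i) τ) < a, opt w (avoid (e i) τ) := by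
          rw [← nsmul_eq_mul]
          exact Finset.card_nsmul_le_sum _ _ _ fun i hi => not_lt.1 (Finset.mem_filter.1 hi).2
      _ ≤ _ := Finset.sum_le_sum_of_subset (Finset.filter_subset _ _)
  have main : ∀ (m : ℕ) (σ : List M), σ.length ≤ m → n * opt w σ ≤
      (8 ^ j + 2 * (j + 1 : ℕ)) * ∑ i ∈ I', opt w (avoid (e i) σ) + n * (8 ^ j * a) := by
    intro m
    induction m with
    | zero =>
      intro σ hσ
      obtain rfl : σ = [] := List.length_eq_zero_iff.1 (by omega)
      simp
    | succ m ihm =>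
      intro σ hσ
      by_cases hle : opt w σ ≤ 8 ^ j * a
      · exact le_add_left (by gcongr)
      obtain ⟨τ, r, υ, rfl, h1, h2⟩ :=
        exists_first_not (fun τ : List M => opt w τ ≤ 8 ^ j * a) (by simp) hle
      have hυ := ihm υ (by simp at hσ; omega)
      have hsplit : τ ++ r :: υ = (τ ++ [r]) ++ υ := by simp
      -- Before `r` and after it, all `j + 1` servers may be repositioned, each at cost at most `a`;
      -- serving `r` alone is free.
      have hopt : opt w (τ ++ r :: υ) ≤ (8 ^ j + 2 * (j + 1 : ℕ)) * a + opt w υ := by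
        calc opt w (τ ++ r :: υ)
            ≤ opt w τ + (∑ i, w i + opt w [r]) + (∑ i, w i + opt w υ) := by
              rw [hsplit]
              exact (opt_append_le w _ υ).trans (by gcongr; exact opt_append_le w τ [r])
          _ ≤ 8 ^ j * a + ((j + 1 : ℕ) * a + 0) + ((j + 1 : ℕ) * a + opt w υ) := by
              have := sum_weight_le hwa
              rw [opt_singleton]
              gcongr
          _ = _ := by ring
      have hsum : ∑ i ∈ I', opt w (avoid (e i) (τ ++ [r])) + ∑ i ∈ I', opt w (avoid (e i) υ) ≤
          ∑ i ∈ I', opt w (avoid (e i) (τ ++ r :: υ)) := by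
        rw [← Finset.sum_add_distrib, hsplit]
        refine Finset.sum_le_sum fun i _ => ?_
        rw [avoid_append _ (τ ++ [r])]
        exact opt_add_opt_le ..
      have hph := phase _ h2
      calc (n : ℝ≥0∞) * opt w (τ ++ r :: υ)
          ≤ n * ((8 ^ j + 2 * (j + 1 : ℕ)) * a + opt w υ) := by gcongr
        _ = (8 ^ j + 2 * (j + 1 : ℕ)) * (n * a) + n * opt w υ := by ring
        _ ≤ (8 ^ j + 2 * (j + 1 : ℕ)) * ∑ i ∈ I', opt w (avoid (e i) (τ ++ [r])) +
            ((8 ^ j + 2 * (j + 1 : ℕ)) * ∑ i ∈ I', opt w (avoid (e i) υ) + n * (8 ^ j * a)) := by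
              gcongr
        _ = (8 ^ j + 2 * (j + 1 : ℕ)) * (∑ i ∈ I', opt w (avoid (e i) (τ ++ [r])) +
            ∑ i ∈ I', opt w (avoid (e i) υ)) + n * (8 ^ j * a) := by ring
        _ ≤ _ := by gcongr
  have hfin := main σ.length σ le_rfl
  have hsumW : ∑ i ∈ I', opt w (avoid (e i) σ) ≤ (2 * n : ℕ) * W := by
    rw [← hcard, ← nsmul_eq_mul]
    exact Finset.sum_le_card_nsmul _ _ _ fun i hi => h i (hI'I hi)
  have haW : a ≤ W := hW _
  have : (n : ℝ≥0∞) * opt w σ ≤ n * (8 ^ (j + 1) * W) := by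
    calc (n : ℝ≥0∞) * opt w σ
        ≤ (8 ^ j + 2 * (j + 1 : ℕ)) * ((2 * n : ℕ) * W) + n * (8 ^ j * W) :=
          hfin.trans (by gcongr)
      _ = n * ((3 * 8 ^ j + 4 * (j + 1) : ℕ) * W) := by push_cast; ring
      _ ≤ n * ((8 ^ (j + 1) : ℕ) * W) := by
          gcongr
          exact_mod_cast three_mul_eight_pow_add_le j
      _ = _ := by push_cast; rfl
  exact (ENNReal.mul_le_mul_iff_right hn0 (ENNReal.natCast_ne_top n)).1 this

/-- If the requests outside each of many disjoint small sets can be served cheaply, then so can all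
requests. -/
theorem opt_le_of_disjoint [Nonempty M] (K j s : ℕ) (h : s + j ≤ K) :
    DisjointCriterion M K j s := by
  induction j generalizing s with
  | zero => exact disjointCriterion_zero K s
  | succ j ih => exact disjointCriterion_succ (by omega) (ih s (by omega)) (ih (s + 1) (by omega))

/-- Either all requests can be served cheaply, or only few locations are such that the requests
elsewhere can be served cheaply. -/
theorem opt_le_or_card_lt [Nonempty M] {j : ℕ} {w : Fin j → ℝ≥0∞} (hw : Monotone w) {W : ℝ≥0∞}
    (hW : ∀ i, w i ≤ W) (σ : List M) :
    opt w σ ≤ 8 ^ j * W ∨ ∃ S : Finset M, (∀ x, x ∈ S ↔ opt w (avoid {x} σ) ≤ W) ∧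
      S.card < dichotomyBound (j + 1) j := by
  by_cases h : ∃ I : Finset M, dichotomyBound (j + 1) j ≤ I.card ∧
      ∀ x ∈ I, opt w (avoid {x} σ) ≤ W
  · obtain ⟨I, hI, hI'⟩ := h
    refine Or.inl (opt_le_of_disjoint (j + 1) j 1 (by omega) w hw W hW σ I (fun x => {x})
      ?_ (by simp) hI (by simpa using hI'))
    intro x _ y _ hxy
    simpa [Function.onFun] using hxy
  · push Not at h
    right
    have hfin : {x | opt w (avoid {x} σ) ≤ W}.Finite := by
      by_contra hinf
      obtain ⟨I, hI, hcard⟩ := Set.Infinite.exists_subset_card_eq hinf (dichotomyBound (j + 1) j)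
      obtain ⟨x, hx, hx'⟩ := h I hcard.ge
      exact absurd (hI hx) (by simpa using hx')
    refine ⟨hfin.toFinset, by simp, ?_⟩
    by_contra! hle
    obtain ⟨x, hx, hx'⟩ := h _ hle
    simp only [Set.Finite.mem_toFinset, Set.mem_ofPred_eq] at hx
    exact absurd hx hx'.not_ge

end Dichotomy

/-! ### Random orders and harmonic sums -/

section Randomness

/-- Under a random permutation, each element of a finite set is equally likely to come first. -/
theorem card_mul_card_perm_min {α : Type*} [Fintype α] [DecidableEq α] [LinearOrder α]
    (I : Finset α) {i : α} (hi : i ∈ I) :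
    I.card * (Finset.univ.filter fun π : Equiv.Perm α => ∀ j ∈ I, π i ≤ π j).card =
      Fintype.card (Equiv.Perm α) := by
  -- Composing with the transposition of `i` and `i'` exchanges the two events. By injectivity,
  -- these events for the elements of `I` partition the permutations.
  have hsame : ∀ i' ∈ I, (Finset.univ.filter fun π : Equiv.Perm α => ∀ j ∈ I, π i' ≤ π j).card =
      (Finset.univ.filter fun π : Equiv.Perm α => ∀ j ∈ I, π i ≤ π j).card := by
    intro i' hi'
    have hswap : ∀ j ∈ I, Equiv.swap i i' j ∈ I := fun j hj => by
      rw [Equiv.swap_apply_def]; split_ifs <;> assumption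
    refine Finset.card_bij' (fun π _ => π * Equiv.swap i i') (fun π _ => π * Equiv.swap i i')
      ?_ ?_ (fun π _ => by simp [mul_assoc]) (fun π _ => by simp [mul_assoc])
    · intro π hπ
      simp only [Finset.mem_filter, Finset.mem_univ, true_and, Equiv.Perm.mul_apply,
        Equiv.swap_apply_left] at hπ ⊢
      exact fun j hj => hπ _ (hswap j hj)
    · intro π hπ
      simp only [Finset.mem_filter, Finset.mem_univ, true_and, Equiv.Perm.mul_apply,
        Equiv.swap_apply_right] at hπ ⊢
      exact fun j hj => hπ _ (hswap j hj)
  rw [← smul_eq_mul, ← Finset.sum_const, ← Finset.sum_congr rfl hsame, ← Finset.card_univ,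
    ← Finset.card_biUnion]
  · congr 1
    ext π
    simp only [Finset.mem_biUnion, Finset.mem_filter, Finset.mem_univ, true_and, iff_true]
    exact Finset.exists_min_image I π ⟨i, hi⟩
  · intro a ha b hb hab
    rw [Function.onFun, Finset.disjoint_left]
    intro π h1 h2
    simp only [Finset.mem_filter, Finset.mem_univ, true_and] at h1 h2
    exact hab (π.injective (le_antisymm (h1 b hb) (h2 a ha)))

/-- The partial sums of the harmonic series, in the extended nonnegative reals. -/
noncomputable def eharmonic (n : ℕ) : ℝ≥0∞ := ∑ i ∈ Finset.range n, ((i + 1 : ℕ) : ℝ≥0∞)⁻¹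

theorem eharmonic_mono : Monotone eharmonic := fun _ _ h =>
  Finset.sum_le_sum_of_subset (Finset.range_subset_range.2 h)

/-- Each of the last `n - m` terms of the sum is at least `1 / n`. -/
theorem sub_mul_inv_add_eharmonic_le {m n : ℕ} (h : m ≤ n) :
    ((n - m : ℕ) : ℝ≥0∞) * (n : ℝ≥0∞)⁻¹ + eharmonic m ≤ eharmonic n := by
  have : ∀ d, m + d ≤ n → (d : ℝ≥0∞) * (n : ℝ≥0∞)⁻¹ + eharmonic m ≤ eharmonic (m + d) := by
    intro d
    induction d with
    | zero => simp
    | succ d ih =>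
      intro hd
      rw [← add_assoc, eharmonic.eq_1 (m + d + 1), Finset.sum_range_succ, ← eharmonic]
      push_cast
      rw [add_mul, one_mul, add_right_comm]
      refine add_le_add (ih (by omega)) ?_
      rw [ENNReal.inv_le_inv]
      exact_mod_cast hd
  simpa [Nat.add_sub_cancel' h] using this (n - m) (by omega)

/-- Each dyadic block contributes at most `1`. This is how only the logarithm of the number of
candidates is paid. -/
theorem eharmonic_two_pow_le (m : ℕ) : eharmonic (2 ^ m) ≤ 1 + m := by
  induction m with
  | zero => simp [eharmonic]
  | succ m ih =>
    rw [pow_succ, mul_two, eharmonic, Finset.sum_range_add, ← eharmonic]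
    push_cast
    rw [← add_assoc]
    refine add_le_add ih ?_
    calc _ ≤ ∑ i ∈ Finset.range (2 ^ m), ((2 : ℝ≥0∞) ^ m)⁻¹ := by
          refine Finset.sum_le_sum fun i _ => ENNReal.inv_le_inv.2 ?_
          rw [add_assoc]
          exact le_self_add
      _ = 1 := by
          simp only [Finset.sum_const, Finset.card_range, nsmul_eq_mul]
          push_cast
          exact ENNReal.mul_inv_cancel (by simp) (by simp)

/-- A choice which is made once and kept thereafter. -/
theorem exists_coherent_choice {α β : Type*} (fresh : List α → Prop) (base : List α → β)
    (b : β) : ∃ g : List α → β, g [] = b ∧ (∀ σ r, fresh σ → g (σ ++ [r]) = base (σ ++ [r])) ∧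
      ∀ σ r, ¬ fresh σ → g (σ ++ [r]) = g σ := by
  classical
  refine ⟨fun σ => List.reverseRecOn σ b fun σ r c => if fresh σ then base (σ ++ [r]) else c,
    by simp, fun σ r h => by simp [h], fun σ r h => by simp [h]⟩

open Classical in
/-- Let `S'` be obtained from `S` by deleting elements. In a random order, the first element of `S`
survives with probability `S'.card / S.card`. -/
theorem card_perm_first_mem_sdiff {α M : Type*} [Fintype α] [LinearOrder α] (idx : M → α)
    {S S' : Finset M} (hS : S' ⊆ S) (hinj : Set.InjOn idx S) :
    ((Finset.univ.filter fun π : Equiv.Perm α =>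
        ∃ x ∈ S \ S', ∀ y ∈ S, π (idx x) ≤ π (idx y)).card : ℝ≥0∞) +
      Fintype.card (Equiv.Perm α) * eharmonic S'.card ≤
        Fintype.card (Equiv.Perm α) * eharmonic S.card := by
  set P := Fintype.card (Equiv.Perm α) with hP
  have hx : ∀ x ∈ S, ((Finset.univ.filter fun π : Equiv.Perm α =>
      ∀ y ∈ S, π (idx x) ≤ π (idx y)).card : ℝ≥0∞) = P * (S.card : ℝ≥0∞)⁻¹ := by
    intro x hx
    have h := card_mul_card_perm_min (S.image idx) (Finset.mem_image_of_mem idx hx)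
    rw [Finset.card_image_of_injOn hinj] at h
    simp only [Finset.forall_mem_image] at h
    rw [hP, ← h]
    push_cast
    rw [mul_comm (S.card : ℝ≥0∞), mul_assoc, ENNReal.mul_inv_cancel, mul_one]
    · simpa using Finset.ne_empty_of_mem hx
    · simp
  have hle : ((Finset.univ.filter fun π : Equiv.Perm α =>
      ∃ x ∈ S \ S', ∀ y ∈ S, π (idx x) ≤ π (idx y)).card : ℝ≥0∞) ≤
      P * (((S.card - S'.card : ℕ) : ℝ≥0∞) * (S.card : ℝ≥0∞)⁻¹) := by
    calc _ ≤ ((∑ x ∈ S \ S', (Finset.univ.filter fun π : Equiv.Perm α =>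
          ∀ y ∈ S, π (idx x) ≤ π (idx y)).card : ℕ) : ℝ≥0∞) := by
          rw [Nat.cast_le]
          refine le_trans (Finset.card_le_card ?_) Finset.card_biUnion_le
          intro π hπ
          simpa using hπ
      _ = ∑ x ∈ S \ S', P * (S.card : ℝ≥0∞)⁻¹ := by
          rw [Nat.cast_sum]
          exact Finset.sum_congr rfl fun x h => hx x (Finset.mem_sdiff.1 h).1
      _ = _ := by
          rw [Finset.sum_const, nsmul_eq_mul, Finset.card_sdiff_of_subset hS]
          ring
  calc _ ≤ P * (((S.card - S'.card : ℕ) : ℝ≥0∞) * (S.card : ℝ≥0∞)⁻¹) + P * eharmonic S'.card := by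
        gcongr
    _ = P * (((S.card - S'.card : ℕ) : ℝ≥0∞) * (S.card : ℝ≥0∞)⁻¹ + eharmonic S'.card) := by ring
    _ ≤ _ := by
        gcongr
        exact sub_mul_inv_add_eharmonic_le (Finset.card_le_card hS)

end Randomness

/-! ### Drawing the location of the heavy server -/

section Location

variable {M : Type u}

open Classical in
/-- While `fresh` holds there is no location. When it fails, a location is drawn at random from
a set of candidates, and again whenever the last location drawn ceases to be a candidate. The
expected number of draws is controlled by a potential. -/
theorem exists_random_location {N : ℕ} (hN : 0 < N) (fresh : List M → Prop)
    (S : List M → Finset M) (hnil : fresh []) (hfresh : ∀ σ r, fresh (σ ++ [r]) → fresh σ)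
    (hS : ∀ σ r, ¬ fresh σ → S (σ ++ [r]) ⊆ S σ) (hcard : ∀ σ, ¬ fresh σ → (S σ).card ≤ N) :
    ∃ (loc : Equiv.Perm (Fin N) → List M → Option M) (Ψ : List M → ℝ≥0∞),
      (∀ π σ, fresh σ → loc π σ = none) ∧
      (∀ π σ, ¬ fresh σ → (S σ).Nonempty → ∃ x ∈ S σ, loc π σ = some x) ∧
      (∀ σ, Ψ σ ≤ 1 + eharmonic N) ∧
      ∀ σ r, ((Finset.univ.filter fun π => loc π (σ ++ [r]) ≠ loc π σ).card : ℝ≥0∞) +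
        Fintype.card (Equiv.Perm (Fin N)) * Ψ (σ ++ [r]) ≤
          Fintype.card (Equiv.Perm (Fin N)) * Ψ σ := by
  have : NeZero N := ⟨hN.ne'⟩
  have hbase : ∀ σ, ∃ f : M → Fin N, ¬ fresh σ → Set.InjOn f (S σ) := by
    intro σ
    by_cases h : fresh σ
    · exact ⟨fun _ => 0, fun h' => absurd h h'⟩
    · obtain ⟨f⟩ := Function.Embedding.nonempty_of_card_le (α := S σ) (β := Fin N)
        (by simpa using hcard σ h)
      obtain ⟨f, hf⟩ := Set.exists_injOn_iff_injective.2 ⟨f, f.injective⟩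
      exact ⟨f, fun _ => hf⟩
  choose base hbase using hbase
  -- The labels are fixed when `fresh` first fails. Since `S` only shrinks afterwards, they stay
  -- injective on it and the random order does not change.
  obtain ⟨g, -, hg1, hg2⟩ := exists_coherent_choice fresh base fun _ => 0
  have hinj : ∀ σ, ¬ fresh σ → Set.InjOn (g σ) (S σ) := by
    intro σ
    induction σ using List.reverseRecOn with
    | nil => exact fun h => absurd hnil h
    | append_singleton σ r ih =>
      intro h
      by_cases hσ : fresh σ
      · rw [hg1 σ r hσ]; exact hbase _ h
      · rw [hg2 σ r hσ]; exact (ih hσ).mono (by exact_mod_cast hS σ r hσ)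
  have hmin : ∀ (π : Equiv.Perm (Fin N)) σ, ∃ o : Option M, (¬ (S σ).Nonempty → o = none) ∧
      ((S σ).Nonempty → ∃ x ∈ S σ, o = some x ∧ ∀ y ∈ S σ, π (g σ x) ≤ π (g σ y)) := by
    intro π σ
    by_cases h : (S σ).Nonempty
    · obtain ⟨x, hx, hx'⟩ := Finset.exists_min_image (S σ) (fun x => π (g σ x)) h
      exact ⟨some x, fun h' => absurd h h', fun _ => ⟨x, hx, rfl, hx'⟩⟩
    · exact ⟨none, fun _ => rfl, fun h' => absurd h' h⟩
  choose first hnone hfirst using hmin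
  -- The potential bounds the expected number of changes still to come; the extra `1` under `fresh`
  -- pays for the first draw.
  refine ⟨fun π σ => if fresh σ then none else first π σ,
    fun σ => if fresh σ then 1 + eharmonic N else eharmonic (S σ).card, ?_, ?_, ?_, ?_⟩
  · intro π σ h
    simp [h]
  · intro π σ h h'
    obtain ⟨x, hx, hx', -⟩ := hfirst π σ h'
    exact ⟨x, hx, by simp [h, hx']⟩
  · intro σ
    dsimp only
    split_ifs with h
    · exact le_rfl
    · exact (eharmonic_mono (hcard σ h)).trans le_add_self
  · intro σ r
    by_cases h' : fresh (σ ++ [r])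
    · simp [h', hfresh σ r h']
    by_cases h : fresh σ
    · simp only [h', h, if_true, if_false]
      rw [mul_add, mul_one]
      gcongr
      · exact (Finset.card_filter_le _ _).trans_eq Finset.card_univ
      · exact eharmonic_mono (hcard _ h')
    · simp only [h', h, if_false]
      refine le_trans ?_ (card_perm_first_mem_sdiff (g σ) (hS σ r h) (hinj σ h))
      gcongr with π
      intro hne
      by_cases hσ : (S σ).Nonempty
      · obtain ⟨x, hx, hxo, hxmin⟩ := hfirst π σ hσ
        refine ⟨x, Finset.mem_sdiff.2 ⟨hx, fun hmem => hne ?_⟩, hxmin⟩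
        obtain ⟨z, hz, hzo, hzmin⟩ := hfirst π (σ ++ [r]) ⟨x, hmem⟩
        have hle := hzmin x hmem
        rw [hg2 σ r h] at hle
        have hzS := hS σ r h hz
        rw [hxo, hzo, hinj σ h hzS hx (π.injective (le_antisymm hle (hxmin z hzS)))]
      · have hσr : ¬ (S (σ ++ [r])).Nonempty := fun h1 => hσ (h1.mono (hS σ r h))
        exact absurd ((hnone π _ hσr).trans (hnone π _ hσ).symm) hne

end Location

/-! ### Cutting the requests into phases -/

section Phases

variable {M : Type u}

open Classical in
/-- The requests of the current phase, and the number of completed phases, when a phase lasts as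
long as its requests satisfy `valid`. -/
noncomputable def phases (valid : List M → Prop) (ρ : List M) : List M × ℕ :=
  ρ.foldl (fun s r => if valid (s.1 ++ [r]) then (s.1 ++ [r], s.2) else ([r], s.2 + 1)) ([], 0)

@[simp] theorem phases_nil (valid : List M → Prop) : phases valid [] = ([], 0) := rfl

theorem phases_concat_of_valid {valid : List M → Prop} {ρ : List M} {r : M}
    (h : valid ((phases valid ρ).1 ++ [r])) :
    phases valid (ρ ++ [r]) = ((phases valid ρ).1 ++ [r], (phases valid ρ).2) := by
  rw [phases, List.foldl_append, ← phases, List.foldl_cons, if_pos h, List.foldl_nil]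

theorem phases_concat_of_not_valid {valid : List M → Prop} {ρ : List M} {r : M}
    (h : ¬ valid ((phases valid ρ).1 ++ [r])) :
    phases valid (ρ ++ [r]) = ([r], (phases valid ρ).2 + 1) := by
  rw [phases, List.foldl_append, ← phases, List.foldl_cons, if_neg h, List.foldl_nil]

/-- The request that breaks a phase opens the next one, so the latest request always belongs to the
current, valid phase and can be served within it. -/
theorem phases_concat_eq_concat (valid : List M → Prop) (h1 : ∀ r, valid [r]) (ρ : List M) (r : M) :
    ∃ τ, (phases valid (ρ ++ [r])).1 = τ ++ [r] ∧ valid (τ ++ [r]) := by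
  by_cases h : valid ((phases valid ρ).1 ++ [r])
  · exact ⟨_, by rw [phases_concat_of_valid h], h⟩
  · exact ⟨[], by rw [phases_concat_of_not_valid h]; rfl, h1 r⟩

theorem valid_phases {valid : List M → Prop} (h0 : valid []) (h1 : ∀ r, valid [r]) (ρ : List M) :
    valid (phases valid ρ).1 := by
  induction ρ using List.reverseRecOn with
  | nil => exact h0
  | append_singleton ρ r _ =>
    obtain ⟨τ, hτ, h⟩ := phases_concat_eq_concat valid h1 ρ r
    rwa [hτ]

/-- If every completed phase is expensive, then so is the whole. -/
theorem phases_mul_le_opt {k : ℕ} {w : Fin k → ℝ≥0∞} {valid : List M → Prop} {W : ℝ≥0∞}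
    (h : ∀ σ, ¬ valid σ → W ≤ opt w σ) (ρ : List M) : (phases valid ρ).2 * W ≤ opt w ρ := by
  -- The continuation `τ` leaves the current phase open. The breaking request counts both for the
  -- phase it breaks and for the one it opens.
  have key : ∀ τ, (phases valid ρ).2 * W + opt w ((phases valid ρ).1 ++ τ) ≤ opt w (ρ ++ τ) := by
    induction ρ using List.reverseRecOn with
    | nil => simp
    | append_singleton ρ r ih =>
      intro τ
      by_cases hv : valid ((phases valid ρ).1 ++ [r])
      · rw [phases_concat_of_valid hv]
        simpa using ih (r :: τ)
      · rw [phases_concat_of_not_valid hv]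
        push_cast
        calc _ = (phases valid ρ).2 * W + (W + opt w (r :: τ)) := by
              rw [add_mul, one_mul, add_assoc]; rfl
          _ ≤ (phases valid ρ).2 * W + opt w ((phases valid ρ).1 ++ r :: τ) := by
              gcongr
              exact (add_le_add_left (h _ hv) _).trans (opt_concat_add_opt_cons_le ..)
          _ ≤ _ := by simpa using ih (r :: τ)
  exact le_self_add.trans ((key []).trans_eq (by simp))

end Phases

/-! ### Finite algorithms and the addition of a heavy server -/

section Algorithm

variable {k : ℕ} {M : Type u}

/-- The cost of the configurations which an online algorithm goes through. -/
noncomputable def runCost (w : Fin k → ℝ≥0∞) (f : List M → Config k M) (ρ : List M) : ℝ≥0∞ :=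
  ∑ i ∈ Finset.range ρ.length, emoveCost w (f (ρ.take i)) (f (ρ.take (i + 1)))

@[simp] theorem runCost_nil (w : Fin k → ℝ≥0∞) (f : List M → Config k M) :
    runCost w f [] = 0 := by simp [runCost]

theorem runCost_concat (w : Fin k → ℝ≥0∞) (f : List M → Config k M) (ρ : List M) (r : M) :
    runCost w f (ρ ++ [r]) = runCost w f ρ + emoveCost w (f ρ) (f (ρ ++ [r])) := by
  rw [runCost, List.length_append, List.length_singleton, Finset.sum_range_succ, runCost]
  congr 1
  · refine Finset.sum_congr rfl fun i hi => ?_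
    have := Finset.mem_range.1 hi
    rw [List.take_append_of_le_length (by omega), List.take_append_of_le_length (by omega)]
  · rw [List.take_append_of_le_length le_rfl, List.take_length, List.take_of_length_le (by simp)]

theorem runCost_avoid_concat (w : Fin k → ℝ≥0∞) (f : List M → Config k M) (s : Set M)
    (σ : List M) (r : M) :
    runCost w f (avoid s (σ ++ [r])) =
      runCost w f (avoid s σ) + emoveCost w (f (avoid s σ)) (f (avoid s (σ ++ [r]))) := by
  rw [avoid_append]
  by_cases h : r ∈ s
  · simp [avoid_cons_of_mem h]
  · rw [avoid_cons_of_notMem h, avoid_nil, runCost_concat]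

/-- A randomized online algorithm with finitely many equally likely outcomes. It serves the
requests which can be served; with no servers, none can be. -/
structure FiniteAlgorithm (w : Fin k → ℝ≥0∞) (C₀ : Config k M) where
  /-- the outcomes of the random choices -/
  Ω : Type
  [fintype : Fintype Ω]
  [nonempty : Nonempty Ω]
  /-- the configuration after serving a sequence of requests -/
  config : Ω → List M → Config k M
  initial : ∀ ω, config ω [] = C₀
  serves : ∀ ω ρ r, opt w (ρ ++ [r]) ≠ ⊤ → ∃ j : Fin k, config ω (ρ ++ [r]) j = r

attribute [instance] FiniteAlgorithm.fintype FiniteAlgorithm.nonempty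

/-- The expected cost exceeds the optimum by at most a factor `c`, up to an additive `c * W`. -/
def FiniteAlgorithm.IsCompetitive {w : Fin k → ℝ≥0∞} {C₀ : Config k M} (A : FiniteAlgorithm w C₀)
    (c W : ℝ≥0∞) : Prop :=
  ∀ ρ, ∑ ω, runCost w (A.config ω) ρ ≤ Fintype.card A.Ω * (c * (opt w ρ + W))

/-- The last server stays at a random location, and the other servers follow an algorithm for the
requests elsewhere. -/
noncomputable def combine {Ω : Type} (x₀ : M) (o : Option M) (f : Ω → List M → Config k M) (ω : Ω)
    (σ : List M) : Config (k + 1) M :=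
  Fin.snoc (f ω (avoid {x | o = some x} σ)) (o.getD x₀)

theorem emoveCost_combine {Ω : Type} (w : Fin (k + 1) → ℝ≥0∞) (x₀ : M) (o : Option M)
    (f : Ω → List M → Config k M) (ω : Ω) (σ τ : List M) :
    emoveCost w (combine x₀ o f ω σ) (combine x₀ o f ω τ) =
      emoveCost (Fin.init w) (f ω (avoid {x | o = some x} σ)) (f ω (avoid {x | o = some x} τ)) := by
  rw [emoveCost_succ _ _ _ (by simp [combine])]
  simp [combine]

theorem exists_combine_eq {Ω : Type} (x₀ : M) (o : Option M) (f : Ω → List M → Config k M) (ω : Ω)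
    (σ : List M) (r : M)
    (h : o ≠ some r → ∃ j, f ω (avoid {x | o = some x} σ ++ [r]) j = r) :
    ∃ j, combine x₀ o f ω (σ ++ [r]) j = r := by
  by_cases hr : o = some r
  · exact ⟨Fin.last k, by simp [combine, hr]⟩
  · obtain ⟨j, hj⟩ := h hr
    refine ⟨j.castSucc, ?_⟩
    rw [combine, Fin.snoc_castSucc, avoid_append, avoid_cons_of_notMem (by simpa using hr)]
    exact hj

end Algorithm

/-! ### The induction on the number of servers -/

section Recursion

variable {M : Type u}

theorem dichotomyExponent_le (K j : ℕ) : dichotomyExponent K j ≤ (K + 2) * (2 ^ (j + 1) - 1) := by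
  induction j with
  | zero => simp [dichotomyExponent]
  | succ j ih =>
    have h : 2 ^ (j + 1 + 1) - 1 = 1 + 2 * (2 ^ (j + 1) - 1) := by
      have := Nat.one_le_two_pow (n := j + 1)
      rw [pow_succ 2 (j + 1)]
      omega
    rw [dichotomyExponent, h, mul_add, mul_one, mul_left_comm]
    omega

/-- The left side is the ratio which one more server produces. Its factors are at most `2 ^ (4 * (j
+ 1))` and `2 ^ (7 * j ^ 2 + 3 * (j + 1))`; the constant `7` is `4 + 3`. -/
theorem competitive_ratio_step (j : ℕ) :
    (3 + dichotomyExponent (j + 1) j) * (j + 1 + 2 ^ (7 * j ^ 2) * (8 ^ j + 1)) ≤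
      2 ^ (7 * (j + 1) ^ 2) := by
  have h1 : 3 + dichotomyExponent (j + 1) j ≤ 2 ^ (4 * (j + 1)) := by
    have h2 := dichotomyExponent_le (j + 1) j
    have h3 : ∀ i : ℕ, 3 + (i + 3) * (2 ^ (i + 1) - 1) ≤ 2 ^ (4 * (i + 1)) := by
      intro i
      have h4 : i + 3 ≤ 2 * 2 ^ (i + 1) := by
        have : i + 1 < 2 ^ (i + 1) := Nat.lt_two_pow_self
        omega
      have h5 : 2 ≤ 2 ^ (i + 1) := by
        rw [pow_succ]; have := Nat.one_le_two_pow (n := i); omega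
      have h6 : 2 ^ (4 * (i + 1)) = (2 ^ (i + 1)) ^ 4 := by rw [← pow_mul, mul_comm]
      rw [h6]
      generalize 2 ^ (i + 1) = a at *
      obtain ⟨b, rfl⟩ := Nat.exists_eq_add_of_le h5
      have : 2 + b - 1 = 1 + b := by omega
      rw [this]
      have := Nat.mul_le_mul_right (1 + b) h4
      nlinarith [sq_nonneg b, Nat.zero_le b]
    exact (Nat.add_le_add_left h2 3).trans (h3 j)
  have h2 : j + 1 + 2 ^ (7 * j ^ 2) * (8 ^ j + 1) ≤ 2 ^ (7 * j ^ 2) * 2 ^ (3 * (j + 1)) := by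
    have h3 : j + 1 + (8 ^ j + 1) ≤ 2 ^ (3 * (j + 1)) := by
      have := three_mul_eight_pow_add_le j
      have h4 := Nat.one_le_pow j 8 (by norm_num)
      rw [pow_mul]
      norm_num
      omega
    have h4 := Nat.one_le_two_pow (n := 7 * j ^ 2)
    calc _ ≤ 2 ^ (7 * j ^ 2) * (j + 1) + 2 ^ (7 * j ^ 2) * (8 ^ j + 1) :=
          Nat.add_le_add_right (Nat.le_mul_of_pos_left _ h4) _
      _ = 2 ^ (7 * j ^ 2) * (j + 1 + (8 ^ j + 1)) := by ring
      _ ≤ _ := Nat.mul_le_mul_left _ h3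
  calc _ ≤ 2 ^ (4 * (j + 1)) * (2 ^ (7 * j ^ 2) * 2 ^ (3 * (j + 1))) := Nat.mul_le_mul h1 h2
    _ = 2 ^ (4 * (j + 1) + (7 * j ^ 2 + 3 * (j + 1))) := by rw [pow_add, pow_add]
    _ ≤ _ := Nat.pow_le_pow_right (by norm_num) (by nlinarith)

-- The outcome is a random order paired with an independent outcome of `A`. One order serves all
-- phases: the phases do not depend on the outcome, and expectations add up.
open Classical in
theorem FiniteAlgorithm.exists_succ {j : ℕ} {w : Fin (j + 1) → ℝ≥0∞} (hw : Monotone w)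
    (hfin : w (Fin.last j) ≠ ⊤) {C₀ : Config (j + 1) M}
    (A : FiniteAlgorithm (Fin.init w) (Fin.init C₀ : Config j M))
    (hA : A.IsCompetitive ((2 ^ (7 * j ^ 2) : ℕ) : ℝ≥0∞) (w (Fin.last j))) :
    ∃ A' : FiniteAlgorithm w C₀,
      A'.IsCompetitive ((2 ^ (7 * (j + 1) ^ 2) : ℕ) : ℝ≥0∞) (w (Fin.last j)) := by
  set W := w (Fin.last j) with hW
  set x₀ := C₀ (Fin.last j) with hx₀
  have : Nonempty M := ⟨x₀⟩
  have hw' : Monotone (Fin.init w) := fun a b hab => hw (Fin.castSucc_le_castSucc_iff.2 hab)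
  have hwW : ∀ i, w i ≤ W := fun i => hw (Fin.le_last i)
  have hiW : ∀ i, Fin.init w i ≤ W := fun i => hwW _
  set N := dichotomyBound (j + 1) j with hN
  set m := dichotomyExponent (j + 1) j with hm
  let fresh : List M → Prop := fun σ => opt (Fin.init w) σ ≤ 8 ^ j * W
  have hS : ∀ σ, ∃ S : Finset M, ¬ fresh σ →
      (∀ x, x ∈ S ↔ opt (Fin.init w) (avoid {x} σ) ≤ W) ∧ S.card < N := by
    intro σ
    rcases opt_le_or_card_lt hw' hiW σ with h | ⟨S, hS⟩
    · exact ⟨∅, fun h' => absurd h h'⟩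
    · exact ⟨S, fun _ => hS⟩
  choose S hS using hS
  have hfresh : ∀ σ r, fresh (σ ++ [r]) → fresh σ := fun σ r h =>
    (le_self_add.trans (opt_add_opt_le _ σ [r])).trans h
  obtain ⟨loc, Ψ, hloc1, hloc2, hΨ, hstep⟩ := exists_random_location (dichotomyBound_pos (j + 1) j)
    fresh S (by simp [fresh]) hfresh
    (fun σ r h x hx => by
      rw [(hS _ fun h' => h (hfresh σ r h')).1, avoid_append] at hx
      exact ((hS σ h).1 x).2 ((le_self_add.trans (opt_add_opt_le _ _ _)).trans hx))
    (fun σ h => (hS σ h).2.le)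
  let valid : List M → Prop := fun σ => fresh σ ∨ (S σ).Nonempty
  have hvalid0 : valid [] := Or.inl (by simp [fresh])
  have hvalid1 : ∀ r, valid [r] := by
    intro r
    by_cases h : fresh [r]
    · exact Or.inl h
    · exact Or.inr ⟨r, ((hS _ h).1 r).2 (by simp [avoid_cons_of_mem])⟩
  have hinvalid : ∀ σ, ¬ valid σ → W ≤ opt w σ := by
    intro σ h
    by_contra! hlt
    obtain ⟨y, hy⟩ := exists_opt_avoid_lt hlt
    exact h (or_iff_not_imp_left.2 fun hf => ⟨y, ((hS σ hf).1 y).2 hy.le⟩)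
  have h8 : (1 : ℝ≥0∞) ≤ 8 ^ j := one_le_pow_of_one_le' (by norm_num) j
  have hlight : ∀ π σ, valid σ →
      opt (Fin.init w) (avoid {x | loc π σ = some x} σ) ≤ 8 ^ j * W := by
    intro π σ h
    by_cases hf : fresh σ
    · simpa [hloc1 π σ hf] using hf
    · obtain ⟨x, hx, hx'⟩ := hloc2 π σ hf (h.resolve_left hf)
      have : {y | loc π σ = some y} = ({x} : Set M) := by
        ext y; simp [hx', eq_comm]
      rw [this]
      exact (((hS σ hf).1 x).1 hx).trans (le_mul_of_one_le_left zero_le h8)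
  -- When the location changes, the light servers jump to where `A` would be had the new location
  -- been in force since the phase began. Each phase restarts `A`.
  let f : Equiv.Perm (Fin N) × A.Ω → List M → Config (j + 1) M := fun ω σ =>
    combine x₀ (loc ω.1 σ) A.config ω.2 σ
  let F : Equiv.Perm (Fin N) × A.Ω → List M → Config (j + 1) M := fun ω ρ =>
    f ω (phases valid ρ).1
  have hinit : ∀ ω, F ω [] = C₀ := by
    intro ω
    have h0 : loc ω.1 [] = none := hloc1 _ _ (by simp [fresh])
    simp only [F, f, phases_nil, combine, h0, avoid_nil, A.initial, Option.getD_none, hx₀]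
    exact Fin.snoc_init_self C₀
  have hserves : ∀ ω ρ r, ∃ i, F ω (ρ ++ [r]) i = r := by
    intro ω ρ r
    obtain ⟨τ, hτ, hv⟩ := phases_concat_eq_concat valid hvalid1 ρ r
    simp only [F, f, hτ]
    refine exists_combine_eq _ _ _ _ _ _ fun hr => A.serves _ _ _ ?_
    have := hlight ω.1 _ hv
    rw [avoid_append, avoid_cons_of_notMem (by simpa using hr)] at this
    exact ne_top_of_le_ne_top (ENNReal.mul_ne_top (by simp) hfin) this
  refine ⟨⟨_, F, hinit, fun ω ρ r _ => hserves ω ρ r⟩, fun ρ => ?_⟩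
  set D : ℝ≥0∞ := ((j + 1 : ℕ) : ℝ≥0∞) * W with hD
  have hmove : ∀ C C' : Config (j + 1) M, emoveCost w C C' ≤ D := fun C C' =>
    (emoveCost_le_sum w C C').trans (sum_weight_le hwW)
  set T : ℝ≥0∞ := ((2 ^ (7 * j ^ 2) : ℕ) : ℝ≥0∞) * (8 ^ j * W + W) with hT
  set p : ℝ≥0∞ := (Fintype.card (Equiv.Perm (Fin N)) : ℝ≥0∞) with hp
  set q : ℝ≥0∞ := (Fintype.card A.Ω : ℝ≥0∞) with hq
  -- the cost of the light servers if they had served the whole phase with the current location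
  let a : Equiv.Perm (Fin N) → List M → ℝ≥0∞ := fun π σ =>
    ∑ ω, runCost (Fin.init w) (A.config ω) (avoid {x | loc π σ = some x} σ)
  have haT : ∀ π σ, valid σ → a π σ ≤ q * T := fun π σ h =>
    (hA _).trans (by rw [hT]; gcongr; exact hlight π σ h)
  have hpq : q * T ≠ ⊤ := ENNReal.mul_ne_top (by simp [hq])
    (ENNReal.mul_ne_top (by simp) (ENNReal.add_ne_top.2 ⟨ENNReal.mul_ne_top (by simp) hfin, hfin⟩))
  have hasum : ∀ σ, valid σ → ∑ π, a π σ ≤ p * (q * T) := fun σ h =>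
    (Finset.sum_le_card_nsmul _ _ _ fun π _ => haT π σ h).trans_eq (by simp [hp])
  -- With the location unchanged, the light servers pay exactly the increment of `a`. A change costs
  -- at most `D` per outcome of `A` and writes off the old simulation, which costs at most `q * T`.
  have hchange : ∀ σ r, valid σ → ∀ π, (∑ ω, emoveCost w (f (π, ω) σ) (f (π, ω) (σ ++ [r]))) +
      a π σ ≤ (if loc π (σ ++ [r]) ≠ loc π σ then q * (D + T) else 0) + a π (σ ++ [r]) := by
    intro σ r hv π
    by_cases h : loc π (σ ++ [r]) = loc π σ
    · simp only [f, a, h, ne_eq, not_true_eq_false, if_false, zero_add]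
      rw [← Finset.sum_add_distrib]
      refine Finset.sum_le_sum fun ω _ => ?_
      rw [emoveCost_combine, runCost_avoid_concat, add_comm]
    · rw [if_pos h, mul_add]
      refine le_add_right (add_le_add ?_ (haT π σ hv))
      exact (Finset.sum_le_card_nsmul _ _ _ fun ω _ => hmove _ _).trans_eq (by simp [hq])
  have hexp : ∀ σ r, valid σ →
      (∑ π, ∑ ω, emoveCost w (f (π, ω) σ) (f (π, ω) (σ ++ [r]))) + ∑ π, a π σ +
        p * (q * (D + T)) * Ψ (σ ++ [r]) ≤
        p * (q * (D + T)) * Ψ σ + ∑ π, a π (σ ++ [r]) := by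
    intro σ r hv
    have h1 := Finset.sum_le_sum fun π (_ : π ∈ Finset.univ) => hchange σ r hv π
    rw [Finset.sum_add_distrib, Finset.sum_add_distrib, ← Finset.sum_filter, Finset.sum_const,
      nsmul_eq_mul] at h1
    have h2 := mul_le_mul_right (hstep σ r) (q * (D + T))
    calc _ ≤ _ := add_le_add_left h1 _
      _ = q * (D + T) * (((Finset.univ.filter fun π => loc π (σ ++ [r]) ≠ loc π σ).card : ℝ≥0∞) +
            p * Ψ (σ ++ [r])) + ∑ π, a π (σ ++ [r]) := by ring
      _ ≤ q * (D + T) * (p * Ψ σ) + ∑ π, a π (σ ++ [r]) := by gcongr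
      _ = _ := by ring
  set X := p * (q * (D + T)) with hX
  -- Per phase, `1 + eharmonic N` units of `X` are the initial potential; one more unit pays for the
  -- last simulation (`T`) and the move into the next phase (`D`).
  have main : ∀ ρ, (∑ π, ∑ ω, runCost w (F (π, ω)) ρ) + X * Ψ (phases valid ρ).1 ≤
      (phases valid ρ).2 * (X * (2 + eharmonic N)) + X * (1 + eharmonic N) +
        ∑ π, a π (phases valid ρ).1 := by
    intro ρ
    induction ρ using List.reverseRecOn with
    | nil =>
      simp only [runCost_nil, Finset.sum_const_zero, zero_add, phases_nil, Nat.cast_zero, zero_mul]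
      exact le_add_right (by gcongr; exact hΨ _)
    | append_singleton ρ r ih =>
      have hv0 := valid_phases hvalid0 hvalid1 ρ
      simp only [runCost_concat, Finset.sum_add_distrib]
      by_cases hv : valid ((phases valid ρ).1 ++ [r])
      · simp only [F, phases_concat_of_valid hv]
        have h1 := hexp (phases valid ρ).1 r hv0
        have hne : ∑ π, a π (phases valid ρ).1 ≠ ⊤ :=
          ne_top_of_le_ne_top (ENNReal.mul_ne_top (by simp [hp]) hpq) (hasum _ hv0)
        refine (ENNReal.add_le_add_iff_right hne).1 ?_
        calc _ = (∑ π, ∑ ω, runCost w (F (π, ω)) ρ) +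
              ((∑ π, ∑ ω, emoveCost w (f (π, ω) (phases valid ρ).1)
                (f (π, ω) ((phases valid ρ).1 ++ [r]))) + ∑ π, a π (phases valid ρ).1 +
                X * Ψ ((phases valid ρ).1 ++ [r])) := by simp only [F]; ring
          _ ≤ (∑ π, ∑ ω, runCost w (F (π, ω)) ρ) + (X * Ψ (phases valid ρ).1 +
                ∑ π, a π ((phases valid ρ).1 ++ [r])) := by gcongr
          _ = ((∑ π, ∑ ω, runCost w (F (π, ω)) ρ) + X * Ψ (phases valid ρ).1) +
                ∑ π, a π ((phases valid ρ).1 ++ [r]) := by ring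
          _ ≤ _ := add_le_add_left ih _
          _ = _ := by ring
      · have h1 : (∑ π, ∑ ω, emoveCost w (F (π, ω) ρ) (F (π, ω) (ρ ++ [r]))) ≤ p * (q * D) := by
          calc _ ≤ ∑ _π : Equiv.Perm (Fin N), ∑ _ω : A.Ω, D := by gcongr; exact hmove _ _
            _ = _ := by simp [hp, hq]
        rw [phases_concat_of_not_valid hv]
        have h2 := hasum _ hv0
        have h3 := le_self_add.trans ih
        push_cast
        refine le_add_right ?_
        calc _ ≤ ((phases valid ρ).2 * (X * (2 + eharmonic N)) + X * (1 + eharmonic N) +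
                p * (q * T)) + p * (q * D) + X * (1 + eharmonic N) := by
              gcongr
              · exact h3.trans (by gcongr)
              · exact hΨ _
          _ = _ := by rw [hX]; ring
  have hend := (le_self_add.trans (main ρ)).trans
    (add_le_add_right (hasum _ (valid_phases hvalid0 hvalid1 ρ)) _)
  have hphases := phases_mul_le_opt hinvalid ρ
  have hN' : eharmonic N ≤ 1 + m := eharmonic_two_pow_le m
  have hfinal : (∑ π, ∑ ω, runCost w (F (π, ω)) ρ) ≤
      p * q * (((2 ^ (7 * (j + 1) ^ 2) : ℕ) : ℝ≥0∞) * (opt w ρ + W)) := by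
    calc _ ≤ _ := hend
      _ ≤ (phases valid ρ).2 * (X * (2 + eharmonic N)) + X * (1 + eharmonic N) + X := by
          gcongr
          rw [hX]
          gcongr
          exact le_add_self
      _ = ((phases valid ρ).2 + 1) * (X * (2 + eharmonic N)) := by ring
      _ ≤ ((phases valid ρ).2 + 1) * (X * (2 + (1 + m))) := by gcongr
      _ = p * q * ((((3 + m) * (j + 1 + 2 ^ (7 * j ^ 2) * (8 ^ j + 1)) : ℕ) : ℝ≥0∞) *
            ((phases valid ρ).2 * W + W)) := by
          rw [hX, hD, hT]; push_cast; ring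
      _ ≤ _ := by
          gcongr
          exact competitive_ratio_step j
  simpa [Fintype.sum_prod_type, Fintype.card_prod, hp, hq] using hfinal

/-- `W` is left free because the step needs the light algorithm with an additive term measured by
the weight of the new, heavier server. -/
theorem FiniteAlgorithm.exists_isCompetitive {k : ℕ} {w : Fin k → ℝ≥0∞} (hw : Monotone w)
    (hfin : ∀ i, w i ≠ ⊤) {W : ℝ≥0∞} (hW : ∀ i, w i ≤ W) (C₀ : Config k M) :
    ∃ A : FiniteAlgorithm w C₀, A.IsCompetitive ((2 ^ (7 * k ^ 2) : ℕ) : ℝ≥0∞) W := by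
  induction k generalizing W with
  | zero =>
    refine ⟨⟨Unit, fun _ _ => C₀, fun _ => rfl, fun _ ρ r h => ?_⟩, fun ρ => ?_⟩
    · simpa using opt_ne_top_zero h
    · simp [runCost]
  | succ j ih =>
    obtain ⟨A, hA⟩ := ih (w := Fin.init w) (W := w (Fin.last j))
      (fun a b hab => hw (Fin.castSucc_le_castSucc_iff.2 hab)) (fun i => hfin _)
      (fun i => hw (Fin.le_last _)) (Fin.init C₀)
    obtain ⟨A', hA'⟩ := FiniteAlgorithm.exists_succ hw (hfin _) A hA
    exact ⟨A', fun ρ => (hA' ρ).trans (by gcongr; exact hW _)⟩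

end Recursion

/-! ### Back to real costs and probability measures -/

section Real

variable {k : ℕ} {M : Type u}

theorem ofReal_moveCost {w : Fin k → ℝ} (hw : ∀ i, 0 ≤ w i) (C C' : Config k M) :
    ENNReal.ofReal (moveCost w C C') = emoveCost (fun i => ENNReal.ofReal (w i)) C C' := by
  rw [moveCost, emoveCost, ENNReal.ofReal_sum_of_nonneg]
  · refine Finset.sum_congr rfl fun i _ => ?_
    unfold uniformDist
    split_ifs <;> simp
  · intro i _
    have := hw i
    unfold uniformDist
    split_ifs <;> simp [this]

theorem moveCost_nonneg {w : Fin k → ℝ} (hw : ∀ i, 0 ≤ w i) (C C' : Config k M) :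
    0 ≤ moveCost w C C' := by
  refine Finset.sum_nonneg fun i _ => mul_nonneg (hw i) ?_
  unfold uniformDist
  split_ifs <;> norm_num

theorem totalCost_nonneg {w : Fin k → ℝ} (hw : ∀ i, 0 ≤ w i) {m : ℕ}
    (𝒞 : Fin (m + 1) → Config k M) : 0 ≤ totalCost w 𝒞 :=
  Finset.sum_nonneg fun _ _ => moveCost_nonneg hw _ _

theorem optFrom_le_totalCost {w : Fin k → ℝ} (hw : ∀ i, 0 ≤ w i) (ρ : List M)
    (𝒞 : Fin (ρ.length + 1) → Config k M) (h : IsSolution ρ 𝒞) :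
    optFrom (fun i => ENNReal.ofReal (w i)) ρ (𝒞 0) ≤ ENNReal.ofReal (totalCost w 𝒞) := by
  induction ρ with
  | nil => simp [optFrom]
  | cons r ρ ih =>
    have ih := ih (fun i => 𝒞 i.succ) fun i => h i.succ
    have hcost : totalCost w 𝒞 = moveCost w (𝒞 0) (𝒞 (Fin.succ 0)) +
        totalCost (m := ρ.length) w (fun i => 𝒞 i.succ) :=
      Fin.sum_univ_succ (n := ρ.length) fun i => moveCost w (𝒞 i.castSucc) (𝒞 i.succ)
    rw [hcost, ENNReal.ofReal_add (moveCost_nonneg hw _ _) (totalCost_nonneg hw _),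
      ofReal_moveCost hw]
    exact (optFrom_cons_le _ ρ (𝒞 0) (h 0)).trans (add_le_add_right ih _)

theorem ofReal_totalCost_run {w : Fin k → ℝ} (hw : ∀ i, 0 ≤ w i) (f : List M → Config k M)
    (ρ : List M) :
    ENNReal.ofReal (totalCost w fun i : Fin (ρ.length + 1) => f (ρ.take i)) =
      runCost (fun i => ENNReal.ofReal (w i)) f ρ := by
  rw [totalCost, runCost, ENNReal.ofReal_sum_of_nonneg fun _ _ => moveCost_nonneg hw _ _,
    ← Fin.sum_univ_eq_sum_range
      (fun i => emoveCost (fun i => ENNReal.ofReal (w i)) (f (ρ.take i)) (f (ρ.take (i + 1))))]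
  exact Finset.sum_congr rfl fun i _ => ofReal_moveCost hw _ _

theorem optFrom_ne_top {w : Fin (k + 1) → ℝ≥0∞} (hfin : ∀ i, w i ≠ ⊤) (σ : List M)
    (C : Config (k + 1) M) : optFrom w σ C ≠ ⊤ := by
  induction σ generalizing C with
  | nil => simp [optFrom]
  | cons r σ ih =>
    refine ne_top_of_le_ne_top (ENNReal.add_ne_top.2 ⟨?_, ih fun _ => r⟩)
      (optFrom_cons_le w σ C ⟨0, rfl⟩)
    exact ne_top_of_le_ne_top (ENNReal.sum_ne_top.2 fun i _ => hfin i) (emoveCost_le_sum ..)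

/-- The uniform law on the outcomes of a finite algorithm. -/
noncomputable def FiniteAlgorithm.toRandomized {w : Fin (k + 1) → ℝ≥0∞} (hfin : ∀ i, w i ≠ ⊤)
    {C₀ : Config (k + 1) M} (A : FiniteAlgorithm w C₀) : RandomizedOnlineAlgorithm C₀ where
  Ω := A.Ω
  events := ⊤
  law := @PMF.toMeasure A.Ω ⊤ (PMF.uniformOfFintype A.Ω)
  isProbability := @PMF.toMeasure.isProbabilityMeasure A.Ω ⊤ _
  config := A.config
  initial := A.initial
  serves ω ρ r := A.serves ω ρ r
    (ne_top_of_le_ne_top (optFrom_ne_top hfin _ C₀) (opt_le_optFrom w _ C₀))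
  measurable _ _ := trivial

theorem FiniteAlgorithm.expectedCost_toRandomized {w : Fin (k + 1) → ℝ≥0∞} (hfin : ∀ i, w i ≠ ⊤)
    {C₀ : Config (k + 1) M} (A : FiniteAlgorithm w C₀) (v : Fin (k + 1) → ℝ) (ρ : List M) :
    (A.toRandomized hfin).expectedCost v ρ = (Fintype.card A.Ω : ℝ)⁻¹ *
      ∑ ω, totalCost v fun i : Fin (ρ.length + 1) => A.config ω (ρ.take i) := by
  let _ : MeasurableSpace A.Ω := ⊤
  have : MeasurableSingletonClass A.Ω := ⟨fun _ => trivial⟩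
  have h := PMF.integral_eq_sum (PMF.uniformOfFintype A.Ω)
    fun ω => totalCost v fun i : Fin (ρ.length + 1) => A.config ω (ρ.take i)
  refine Eq.trans h ?_
  simp [Finset.mul_sum]

theorem OPT_set_nonempty (w : Fin (k + 1) → ℝ) (C₀ : Config (k + 1) M) (ρ : List M) :
    {x : ℝ | ∃ 𝒞 : Fin (ρ.length + 1) → Config (k + 1) M,
      IsSolution ρ 𝒞 ∧ x = totalCost w 𝒞}.Nonempty :=
  ⟨_, Fin.cases C₀ fun i _ => ρ.get i, fun _ => ⟨0, rfl⟩, rfl⟩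

theorem FiniteAlgorithm.IsCompetitive.expectedCost_le {w : Fin (k + 1) → ℝ} (hw : ∀ i, 0 ≤ w i)
    (hfin : ∀ i, ENNReal.ofReal (w i) ≠ ⊤) {C₀ : Config (k + 1) M}
    {A : FiniteAlgorithm (fun i => ENNReal.ofReal (w i)) C₀} {c : ℕ} (hc : 0 < c) {W : ℝ}
    (hW : 0 ≤ W) (hA : A.IsCompetitive c (ENNReal.ofReal W)) (ρ : List M) :
    (A.toRandomized hfin).expectedCost w ρ ≤ c * OPT w ρ + c * W := by
  have hc' : (0 : ℝ) < c := by exact_mod_cast hc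
  have hcard : (0 : ℝ) < Fintype.card A.Ω := by exact_mod_cast Fintype.card_pos
  -- Solved for `OPT`, the bound can be checked against each solution separately, and only the
  -- inequality from `opt` to the cost of a solution is needed.
  have key : ((A.toRandomized hfin).expectedCost w ρ - c * W) / c ≤ OPT w ρ := by
    refine le_csInf (OPT_set_nonempty w C₀ ρ) ?_
    rintro x ⟨𝒞, h𝒞, rfl⟩
    have hx := totalCost_nonneg hw 𝒞
    rw [div_le_iff₀ hc', sub_le_iff_le_add, FiniteAlgorithm.expectedCost_toRandomized,
      inv_mul_le_iff₀ hcard, ← ENNReal.ofReal_le_ofReal_iff (by positivity),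
      ENNReal.ofReal_sum_of_nonneg fun _ _ => totalCost_nonneg hw _]
    simp only [ofReal_totalCost_run hw]
    calc _ ≤ (Fintype.card A.Ω : ℝ≥0∞) * (c * (opt _ ρ + ENNReal.ofReal W)) := hA ρ
      _ ≤ (Fintype.card A.Ω : ℝ≥0∞) *
            (c * (ENNReal.ofReal (totalCost w 𝒞) + ENNReal.ofReal W)) := by
          gcongr
          exact (opt_le_optFrom _ ρ _).trans (optFrom_le_totalCost hw ρ 𝒞 h𝒞)
      _ = ENNReal.ofReal (Fintype.card A.Ω * (c * (totalCost w 𝒞 + W))) := by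
          rw [ENNReal.ofReal_mul (by positivity), ENNReal.ofReal_mul (by positivity),
            ENNReal.ofReal_natCast, ENNReal.ofReal_natCast, ENNReal.ofReal_add hx hW]
      _ = _ := by congr 1; ring
  rw [div_le_iff₀ hc'] at key
  linarith

end Real

end WeightedKServer

theorem theorem1 :
    ∃ c : ℕ → ℝ,
      (∃ K : ℝ, ∀ k : ℕ, 1 ≤ k → c k ≤ Real.exp (K * (k : ℝ) ^ 2)) ∧
      ∀ k : ℕ, 1 ≤ k →
        ∀ w : Fin k → ℝ, (∀ i, 0 ≤ w i) → Monotone w →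
          ∃ c' : ℝ,
            ∀ (M : Type u) (C₀ : WeightedKServer.Config k M),
              ∃ A : WeightedKServer.RandomizedOnlineAlgorithm C₀,
                ∀ ρ : List M,
                  A.expectedCost w ρ ≤ c k * WeightedKServer.OPT w ρ + c' := by
  refine ⟨fun k => ((2 ^ (7 * k ^ 2) : ℕ) : ℝ), ⟨7, fun k _ => ?_⟩, fun k hk w hw hmono => ?_⟩
  · have h2 : (2 : ℝ) ≤ Real.exp 1 := by linarith [Real.add_one_le_exp (1 : ℝ)]
    calc ((2 ^ (7 * k ^ 2) : ℕ) : ℝ) = 2 ^ (7 * k ^ 2) := by push_cast; rfl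
      _ ≤ Real.exp 1 ^ (7 * k ^ 2) := by gcongr
      _ = Real.exp (7 * (k : ℝ) ^ 2) := by rw [← Real.exp_nat_mul]; push_cast; ring_nf
  · obtain ⟨j, rfl⟩ := Nat.exists_eq_add_of_le' hk
    refine ⟨((2 ^ (7 * (j + 1) ^ 2) : ℕ) : ℝ) * w (Fin.last j), fun M C₀ => ?_⟩
    have hfin : ∀ i, ENNReal.ofReal (w i) ≠ ⊤ := fun i => ENNReal.ofReal_ne_top
    obtain ⟨A, hA⟩ := WeightedKServer.FiniteAlgorithm.exists_isCompetitive
      (w := fun i => ENNReal.ofReal (w i))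
      (fun a b hab => ENNReal.ofReal_le_ofReal (hmono hab)) hfin
      (fun i => ENNReal.ofReal_le_ofReal (hmono (Fin.le_last i))) C₀
    exact ⟨A.toRandomized hfin, hA.expectedCost_le hw hfin (by positivity) (hw _)⟩
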